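/- Let $\mathbb E^5_1$ be $\mathbb R^5$ with the inner product $\langle v,w\rangle=-v_0w_0+v_1w_1+v_2w_2+v_3w_3+v_4w_4$, let $\mathbb S^4_1(1)=\{x\in\mathbb E^5_1:\langle x,x\rangle=1\}$ be the de Sitter space-time, and let $M$ be a smooth oriented space-like (immersed) surface in $\mathbb S^4_1(1)\subset\mathbb E^5_1$. Let $\nu=e_1\wedge e_2: M\to\Lambda^2(\mathbb E^5_1)$ be its Gauss map, where $\{e_1,e_2\}$ is any positively oriented local orthonormal frame field of the tangent bundle, let $\Delta=\sum_{i=1}^2(-e_ie_i+\nabla_{e_i}e_i)$ be the Laplace operator of the induced metric (acting componentwise on $\Lambda^2(\mathbb E^5_1)$-valued functions), let $K$ be the Gaussian curvature of the induced metric, and let $H=\tfrac12\,\mathrm{tr}\,h$ be the mean curvature vector, where $h$ is the second fundamental form of $M$ in $\mathbb S^4_1(1)$. Suppose that $M$ has pointwise 1-type Gauss map, i.e. that $$\Delta\nu=f(\nu+C)$$ on $M$ for a smooth function $f:M\to\mathbb R$ and a constant vector $C\in\Lambda^2(\mathbb E^5_1)$. Then necessarily $$f=4-2K+4\langle H,H\rangle\quad\text{on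 } M,$$ and $C=0$ unless $f$ vanishes identically. In particular, in every case the equation $\Delta\nu=f(\nu+C)$ is satisfied with $f=4-2K+4\langle H,H\rangle$ and $C=0$, that is, $\Delta\nu=(4-2K+4\langle H,H\rangle)\,\nu$. -/

import Mathlib

open scoped Manifold ContDiff

noncomputable section

namespace DeSitterSurface

/-- The coordinate plane on which surfaces are modelled. -/
abbrev Plane : Type := EuclideanSpace ℝ (Fin 2)

/-- The vector space underlying the Minkowski space `𝔼⁵₁`. -/
abbrev E51 : Type := Fin 5 → ℝ

/-- The inner product `⟨v, w⟩ = -v₀w₀ + v₁w₁ + v₂w₂ + v₃w₃ + v₄w₄` of `𝔼⁵₁`. -/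
def mink (v w : E51) : ℝ :=
  -(v 0 * w 0) + v 1 * w 1 + v 2 * w 2 + v 3 * w 3 + v 4 * w 4

/-- The de Sitter space-time `𝕊⁴₁(1) ⊂ 𝔼⁵₁`. -/
def deSitter : Set E51 := {v | mink v v = 1}

/-- The space `Λ²(𝔼⁵₁)` of bivectors. -/
abbrev Bivector : Type := ⋀[ℝ]^2 E51

/-- The bivector `v ∧ w`. -/
def wedge (v w : E51) : Bivector := exteriorPower.ιMulti ℝ 2 ![v, w]

/-- The basis `(E_i ∧ E_j)`, `i < j`, of `Λ²(𝔼⁵₁)`. -/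
def bivectorBasis : Module.Basis (Set.powersetCard (Fin 5) 2) ℝ Bivector :=
  (Pi.basisFun ℝ (Fin 5)).exteriorPower 2

/-! ### Surfaces given by a parametrization `X` of an open part of the plane -/

section Local

/-- The partial derivative `∂ᵢ F`. -/
def pd {V : Type*} [NormedAddCommGroup V] [NormedSpace ℝ V] (i : Fin 2) (F : Plane → V)
    (u : Plane) : V :=
  fderiv ℝ F u (EuclideanSpace.single i 1)

/-- The induced metric `g_ij = ⟨∂ᵢX, ∂ⱼX⟩`. -/
def metric (X : Plane → E51) (u : Plane) : Matrix (Fin 2) (Fin 2) ℝ :=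
  Matrix.of fun i j => mink (pd i X u) (pd j X u)

/-- The Christoffel symbols `Γᵏ_ij` of the Levi-Civita connection of the induced metric. -/
def christoffel (X : Plane → E51) (k i j : Fin 2) (u : Plane) : ℝ :=
  (1 / 2) * ∑ l, (metric X u)⁻¹ k l *
    (pd i (fun w => metric X w j l) u + pd j (fun w => metric X w i l) u
      - pd l (fun w => metric X w i j) u)

/-- The component `Rˡ_kij` of the curvature tensor: `R(∂ᵢ, ∂ⱼ)∂ₖ = ∑ₗ Rˡ_kij ∂ₗ`, where
`R(U, V) = ∇_U ∇_V - ∇_V ∇_U - ∇_[U,V]`. -/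
def riemann (X : Plane → E51) (l k i j : Fin 2) (u : Plane) : ℝ :=
  pd i (christoffel X l j k) u - pd j (christoffel X l i k) u
    + ∑ m, (christoffel X l i m u * christoffel X m j k u
      - christoffel X l j m u * christoffel X m i k u)

/-- The Gaussian curvature `K = ⟨R(∂₀, ∂₁)∂₁, ∂₀⟩ / det g` of the induced metric. -/
def localGaussCurvature (X : Plane → E51) (u : Plane) : ℝ :=
  (∑ l, riemann X l 1 0 1 u * metric X u l 0) / (metric X u).det

/-- The Laplace operator `Δφ = -∑ g^ij (∂ᵢ∂ⱼφ - ∑ₖ Γᵏ_ij ∂ₖφ)` of the induced metric (with the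
geometer's sign), which in an orthonormal frame reads `∑ᵢ (-eᵢeᵢ + ∇_{eᵢ}eᵢ)φ`. -/
def localLaplacian (X : Plane → E51) (φ : Plane → ℝ) (u : Plane) : ℝ :=
  -∑ i, ∑ j, (metric X u)⁻¹ i j * (pd i (pd j φ) u - ∑ k, christoffel X k i j u * pd k φ u)

/-- The covariant derivative of `∂ⱼX` along `∂ᵢX` for the Levi-Civita connection of `𝕊⁴₁(1)`:
the part of `∂ᵢ∂ⱼX` orthogonal to the unit normal `X` of `𝕊⁴₁(1)` in `𝔼⁵₁`. -/
def ambientCovDeriv (X : Plane → E51) (i j : Fin 2) (u : Plane) : E51 :=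
  pd i (pd j X) u - mink (pd i (pd j X) u) (X u) • X u

/-- The second fundamental form `h(∂ᵢ, ∂ⱼ)` in `𝕊⁴₁(1)`, by the Gauss formula. -/
def secondFundForm (X : Plane → E51) (i j : Fin 2) (u : Plane) : E51 :=
  ambientCovDeriv X i j u - ∑ k, christoffel X k i j u • pd k X u

/-- The mean curvature vector `H = ½ tr h` in `𝕊⁴₁(1)`. -/
def localMeanCurvature (X : Plane → E51) (u : Plane) : E51 :=
  (1 / 2 : ℝ) • ∑ i, ∑ j, (metric X u)⁻¹ i j • secondFundForm X i j u

end Local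

/-! ### Immersed surfaces -/

section Global

variable {M : Type*} [TopologicalSpace M] [ChartedSpace Plane M]

/-- `x : M → 𝔼⁵₁` is a smooth immersion of the surface `M` into `𝕊⁴₁(1)` whose induced metric is
positive definite. -/
structure IsSpacelikeSurface (x : M → E51) : Prop where
  smooth : ContMDiff (𝓡 2) 𝓘(ℝ, E51) ∞ x
  mem_deSitter : ∀ p, x p ∈ deSitter
  spacelike : ∀ (p : M) (v : TangentSpace (𝓡 2) p), v ≠ 0 →
    0 < mink (mfderiv (𝓡 2) 𝓘(ℝ, E51) x p v) (mfderiv (𝓡 2) 𝓘(ℝ, E51) x p v)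

/-- A function on `M` read in the preferred chart around `p`. -/
def readAt {V : Type*} (p : M) (F : M → V) : Plane → V :=
  F ∘ (chartAt Plane p).symm

/-- The Gaussian curvature `K` of the metric induced by `x`. -/
def gaussCurvature (x : M → E51) (p : M) : ℝ :=
  localGaussCurvature (readAt p x) (chartAt Plane p p)

/-- The mean curvature vector field `H` of the surface `x` in `𝕊⁴₁(1)`. -/
def meanCurvature (x : M → E51) (p : M) : E51 :=
  localMeanCurvature (readAt p x) (chartAt Plane p p)

/-- The Laplace operator `Δ` of the metric induced by `x`, on functions. -/
def laplacian (x : M → E51) (φ : M → ℝ) (p : M) : ℝ :=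
  localLaplacian (readAt p x) (readAt p φ) (chartAt Plane p p)

/-- The Laplace operator on bivector-valued functions, which acts on components. -/
def bivectorLaplacian (x : M → E51) (F : M → Bivector) (p : M) : Bivector :=
  ∑ s, laplacian x (fun q => bivectorBasis.repr (F q) s) p • bivectorBasis s

/-- `e₁, e₂` is a smooth orthonormal frame field of the tangent bundle of the surface `x` over the
set `U`, its vectors being regarded as vectors of `𝔼⁵₁`. -/
structure IsTangentFrameOn (x : M → E51) (U : Set M) (e₁ e₂ : M → E51) : Prop where
  smooth₁ : ContMDiffOn (𝓡 2) 𝓘(ℝ, E51) ∞ e₁ U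
  smooth₂ : ContMDiffOn (𝓡 2) 𝓘(ℝ, E51) ∞ e₂ U
  tangent₁ : ∀ q ∈ U, ∃ v : TangentSpace (𝓡 2) q, e₁ q = mfderiv (𝓡 2) 𝓘(ℝ, E51) x q v
  tangent₂ : ∀ q ∈ U, ∃ v : TangentSpace (𝓡 2) q, e₂ q = mfderiv (𝓡 2) 𝓘(ℝ, E51) x q v
  unit₁ : ∀ q ∈ U, mink (e₁ q) (e₁ q) = 1
  unit₂ : ∀ q ∈ U, mink (e₂ q) (e₂ q) = 1
  orthogonal : ∀ q ∈ U, mink (e₁ q) (e₂ q) = 0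

/-- `ν` is the Gauss map of the surface `x` for some orientation of `M`: locally `ν = e₁ ∧ e₂` for
a smooth orthonormal tangent frame field. Orientations of `M` and maps `ν` of this kind determine
each other, the positive frames being those with `e₁ ∧ e₂ = ν`; such a `ν` exists exactly when `M`
is orientable. -/
def IsGaussMap (x : M → E51) (ν : M → Bivector) : Prop :=
  ∀ p : M, ∃ U : Set M, IsOpen U ∧ p ∈ U ∧ ∃ e₁ e₂ : M → E51,
    IsTangentFrameOn x U e₁ e₂ ∧ ∀ q ∈ U, ν q = wedge (e₁ q) (e₂ q)

/-- `Δν = f (ν + C)` for the smooth function `f` and the constant vector `C`. The surface has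
pointwise 1-type Gauss map `ν` if this holds for some `f` and `C`. -/
def PointwiseOneTypeEq (x : M → E51) (ν : M → Bivector) (f : M → ℝ) (C : Bivector) : Prop :=
  ContMDiff (𝓡 2) 𝓘(ℝ, ℝ) ∞ f ∧ ∀ p, bivectorLaplacian x ν p = f p • (ν p + C)

end Global

end DeSitterSurface

end

noncomputable section

namespace DeSitterSurface

/-! ### The inner product and bivectors -/

/-! In a chart write ν = s ∂₀X ∧ ∂₁X with s² det g = 1. As a surface in the flat space 𝔼⁵₁, `X` has
second fundamental form h̃ = h - g X. The proof rests on three kinds of components of Δν, each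
tested against a bivector a ∧ b frozen at the point.

Along ν the component is |h̃|², which equals |tr h̃|² - 2K by the Gauss equation
(`sum_riemann_mul_metric`); since tr h̃ = 2H - 2X, this is 4 - 2K + 4⟨H,H⟩
(`localLaplacian_tangentComponent_tangent`). Along X ∧ b the component is zero, because X is an
umbilic normal direction (`localLaplacian_tangentComponent_position`). As ν is orthogonal to X ∧ b
too, f⟨C, X ∧ b⟩ = 0.

Where f ≠ 0, X therefore stays in the radical N of the alternating form (a, b) ↦ ⟨C, a ∧ b⟩, and so
do its derivatives. Thus N contains the 3-space T spanned by X, ∂₀X, ∂₁X. If dim N ≥ 4, the form has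
rank at most one, hence is zero. Otherwise N = T, so every ∂ᵢ∂ⱼX lies in T and h = 0 at the point;
then neither Δν nor ν has a component along a ∧ b with a, b ⟂ T
(`localLaplacian_tangentComponent_normal`), and C = 0 again (`eq_zero_of_laplacian_eq`). So fC = 0
everywhere, and comparing components along ν gives f. -/

lemma mink_comm (v w : E51) : mink v w = mink w v := by
  simp only [mink]; ring

lemma mink_add_left (v v' w : E51) : mink (v + v') w = mink v w + mink v' w := by
  simp only [mink, Pi.add_apply]; ring

lemma mink_smul_left (c : ℝ) (v w : E51) : mink (c • v) w = c * mink v w := by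
  simp only [mink, Pi.smul_apply, smul_eq_mul]; ring

lemma mink_add_right (v w w' : E51) : mink v (w + w') = mink v w + mink v w' := by
  simp only [mink, Pi.add_apply]; ring

lemma mink_smul_right (c : ℝ) (v w : E51) : mink v (c • w) = c * mink v w := by
  simp only [mink, Pi.smul_apply, smul_eq_mul]; ring

lemma mink_sub_left (v v' w : E51) : mink (v - v') w = mink v w - mink v' w := by
  simp only [mink, Pi.sub_apply]; ring

lemma mink_sub_right (v w w' : E51) : mink v (w - w') = mink v w - mink v w' := by
  simp only [mink, Pi.sub_apply]; ring

/-- The inner product as a bilinear map. -/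
def minkBilin : E51 →ₗ[ℝ] E51 →ₗ[ℝ] ℝ :=
  LinearMap.mk₂ ℝ mink mink_add_left mink_smul_left mink_add_right mink_smul_right

/-- The inner product as a continuous bilinear map. -/
def minkCLM : E51 →L[ℝ] E51 →L[ℝ] ℝ := minkBilin.toContinuousBilinearMap

lemma minkCLM_apply (v w : E51) : minkCLM v w = mink v w := rfl

/-- The inner product `F ↦ ⟨F, a ∧ b⟩` of `Λ²(𝔼⁵₁)`. -/
def pairing (a b : E51) : Module.Dual ℝ Bivector :=
  exteriorPower.alternatingMapToDual ℝ E51 2 ![minkBilin a, minkBilin b]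

lemma pairing_wedge (a b v w : E51) :
    pairing a b (wedge v w) = mink v a * mink w b - mink v b * mink w a := by
  simp only [pairing, wedge, exteriorPower.alternatingMapToDual_apply_ιMulti, Matrix.det_fin_two,
    Matrix.of_apply]
  simp [minkBilin, mink_comm]

lemma pairing_add_left (a a' b : E51) (F : Bivector) :
    pairing (a + a') b F = pairing a b F + pairing a' b F := by
  have := congrArg (fun G => G F) ((exteriorPower.alternatingMapToDual ℝ E51 2).map_vecCons_add
    (m := ![minkBilin b]) (minkBilin a) (minkBilin a'))
  simpa [pairing] using this

lemma pairing_smul_left (c : ℝ) (a b : E51) (F : Bivector) :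
    pairing (c • a) b F = c * pairing a b F := by
  have := congrArg (fun G => G F) ((exteriorPower.alternatingMapToDual ℝ E51 2).map_vecCons_smul
    (m := ![minkBilin b]) c (minkBilin a))
  simpa [pairing] using this

lemma pairing_swap (a b : E51) (F : Bivector) : pairing b a F = -pairing a b F := by
  have := congrArg (fun G => G F) ((exteriorPower.alternatingMapToDual ℝ E51 2).map_swap
    ![minkBilin a, minkBilin b] (i := 0) (j := 1) (by decide))
  have e : (![minkBilin a, minkBilin b] ∘ Equiv.swap (0 : Fin 2) 1)
      = ![minkBilin b, minkBilin a] := by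
    funext i; fin_cases i <;> simp
  rw [e] at this
  simpa [pairing] using this

/-- The inner product of `F` with `a ∧ b`, as a bilinear map in `a` and `b`. -/
def pairingBilin (F : Bivector) : E51 →ₗ[ℝ] E51 →ₗ[ℝ] ℝ :=
  LinearMap.mk₂ ℝ (fun a b => pairing a b F) (fun _ _ _ => pairing_add_left _ _ _ _)
    (fun _ _ _ => pairing_smul_left _ _ _ _)
    (fun a b b' => by
      rw [pairing_swap, pairing_add_left, pairing_swap b a, pairing_swap b' a]; ring)
    (fun c a b => by
      rw [pairing_swap, pairing_smul_left, pairing_swap b a, smul_eq_mul]; ring)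

lemma pairingBilin_apply (F : Bivector) (a b : E51) : pairingBilin F a b = pairing a b F := rfl

/-- The basis of `𝔼⁵₁` dual to the standard basis. -/
def dualVec (i : Fin 5) : E51 := Pi.single i (if i = 0 then -1 else 1)

lemma minkBilin_dualVec (i : Fin 5) : minkBilin (dualVec i) = (Pi.basisFun ℝ (Fin 5)).coord i := by
  ext j
  fin_cases i <;> fin_cases j <;> simp [minkBilin, mink, dualVec]

/-- Coordinates are themselves pairings with decomposable bivectors; this links the componentwise
Laplacian to arbitrary test bivectors a ∧ b. -/
lemma exists_repr_eq_pairing (s : Set.powersetCard (Fin 5) 2) :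
    ∃ a b : E51, ∀ F : Bivector, bivectorBasis.repr F s = pairing a b F := by
  refine ⟨dualVec (Set.powersetCard.ofFinEmbEquiv.symm s 0),
    dualVec (Set.powersetCard.ofFinEmbEquiv.symm s 1), fun F => ?_⟩
  rw [bivectorBasis, exteriorPower.basis_repr_apply, exteriorPower.ιMultiDual, pairing,
    exteriorPower.ιMulti_family, exteriorPower.pairingDual,
    exteriorPower.alternatingMapLinearEquiv_apply_ιMulti]
  congr 2
  funext i
  fin_cases i <;> simp [minkBilin_dualVec]

lemma eq_zero_of_pairing_eq_zero {F : Bivector} (hF : ∀ a b, pairing a b F = 0) : F = 0 := by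
  apply bivectorBasis.repr.injective
  ext s
  obtain ⟨a, b, h⟩ := exists_repr_eq_pairing s
  rw [h, hF]; simp

lemma pairing_eq_sum_repr (a b : E51) (F : Bivector) :
    pairing a b F = ∑ s, bivectorBasis.repr F s * pairing a b (bivectorBasis s) := by
  conv_lhs => rw [← bivectorBasis.sum_repr F]
  simp only [map_sum, map_smul, smul_eq_mul]

lemma wedge_combination (a b c d : ℝ) (v w : E51) :
    wedge (a • v + b • w) (c • v + d • w) = (a * d - b * c) • wedge v w := by
  rw [← sub_eq_zero]
  apply eq_zero_of_pairing_eq_zero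
  intro p q
  simp only [map_sub, map_smul, pairing_wedge, mink_add_left, mink_smul_left, smul_eq_mul]
  ring

/-- A bivector annihilated by a subspace of codimension at most one vanishes. -/
lemma eq_zero_of_four_le_finrank {F : Bivector}
    (hF : 4 ≤ Module.finrank ℝ (LinearMap.ker (pairingBilin F))) : F = 0 := by
  have hr := Submodule.finrank_quotient_add_finrank (LinearMap.ker (pairingBilin F))
  rw [Module.finrank_fin_fun] at hr
  obtain ⟨w', hw'⟩ := finrank_le_one_iff.mp
    (show Module.finrank ℝ (E51 ⧸ LinearMap.ker (pairingBilin F)) ≤ 1 by omega)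
  obtain ⟨w, rfl⟩ := Submodule.Quotient.mk_surjective _ w'
  -- Modulo the radical every vector is a multiple of `w`, so the whole form is a multiple of its
  -- value at (w, w), which vanishes by antisymmetry.
  have key : ∀ a, ∃ c : ℝ, ∀ b, pairing a b F = c * pairing w b F := by
    intro a
    obtain ⟨c, hc⟩ := hw' (Submodule.Quotient.mk a)
    refine ⟨c, fun b => ?_⟩
    rw [← Submodule.Quotient.mk_smul, Submodule.Quotient.eq, LinearMap.mem_ker] at hc
    have := congrArg (fun ψ => ψ b) hc
    simp only [map_sub, map_smul, LinearMap.sub_apply, LinearMap.smul_apply, pairingBilin_apply,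
      smul_eq_mul, LinearMap.zero_apply] at this
    linarith
  have hww : pairing w w F = 0 := by linarith [pairing_swap w w F]
  apply eq_zero_of_pairing_eq_zero
  intro a b
  obtain ⟨c, hc⟩ := key a
  obtain ⟨d, hd⟩ := key b
  rw [hc, pairing_swap b w F, hd, hww]; ring

/-! ### Partial derivatives -/

section Calculus

variable {V : Type*} [NormedAddCommGroup V] [NormedSpace ℝ V]

lemma pd_congr {i : Fin 2} {F G : Plane → V} {u : Plane} (h : F =ᶠ[nhds u] G) :
    pd i F u = pd i G u := by
  rw [pd, pd, h.fderiv_eq]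

lemma pd_eventuallyEq {i : Fin 2} {F G : Plane → V} {u : Plane} (h : F =ᶠ[nhds u] G) :
    pd i F =ᶠ[nhds u] pd i G := by
  filter_upwards [h.eventuallyEq_nhds] with w hw using pd_congr hw

lemma pd_const (i : Fin 2) (c : V) (u : Plane) : pd i (fun _ => c) u = 0 := by
  simp [pd]

lemma pd_add {i : Fin 2} {F G : Plane → V} {u : Plane} (hF : DifferentiableAt ℝ F u)
    (hG : DifferentiableAt ℝ G u) : pd i (fun w => F w + G w) u = pd i F u + pd i G u := by
  rw [pd, fderiv_fun_add hF hG]; rfl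

lemma pd_sub {i : Fin 2} {F G : Plane → V} {u : Plane} (hF : DifferentiableAt ℝ F u)
    (hG : DifferentiableAt ℝ G u) : pd i (fun w => F w - G w) u = pd i F u - pd i G u := by
  rw [pd, fderiv_fun_sub hF hG]; rfl

lemma pd_smul {i : Fin 2} {a : Plane → ℝ} {F : Plane → V} {u : Plane}
    (ha : DifferentiableAt ℝ a u) (hF : DifferentiableAt ℝ F u) :
    pd i (fun w => a w • F w) u = a u • pd i F u + pd i a u • F u := by
  rw [pd, fderiv_fun_smul ha hF]; rfl

lemma pd_mul {i : Fin 2} {a b : Plane → ℝ} {u : Plane}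
    (ha : DifferentiableAt ℝ a u) (hb : DifferentiableAt ℝ b u) :
    pd i (fun w => a w * b w) u = a u * pd i b u + pd i a u * b u :=
  pd_smul ha hb

lemma pd_mink {i : Fin 2} {F G : Plane → E51} {u : Plane} (hF : DifferentiableAt ℝ F u)
    (hG : DifferentiableAt ℝ G u) :
    pd i (fun w => mink (F w) (G w)) u = mink (pd i F u) (G u) + mink (F u) (pd i G u) := by
  have := minkCLM.fderiv_of_bilinear hF hG
  simp only [minkCLM_apply] at this
  rw [pd, this, add_comm]
  rfl

lemma pd_mink_const {i : Fin 2} {F : Plane → E51} {u : Plane} (hF : DifferentiableAt ℝ F u)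
    (a : E51) : pd i (fun w => mink (F w) a) u = mink (pd i F u) a := by
  rw [pd_mink hF (differentiableAt_const a), pd_const]
  simp [mink]

lemma pd_sum {ι : Type*} {i : Fin 2} {s : Finset ι} {F : ι → Plane → V} {u : Plane}
    (hF : ∀ k ∈ s, DifferentiableAt ℝ (F k) u) :
    pd i (fun w => ∑ k ∈ s, F k w) u = ∑ k ∈ s, pd i (F k) u := by
  rw [pd, fderiv_fun_sum hF]
  simp [pd]

lemma pd_comm {F : Plane → V} {u : Plane} (hF : ContDiffAt ℝ ∞ F u) (i j : Fin 2) :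
    pd i (pd j F) u = pd j (pd i F) u := by
  have hF2 : ContDiffAt ℝ 2 F u := contDiffAt_infty.1 hF 2
  have hs : IsSymmSndFDerivAt ℝ F u := hF2.isSymmSndFDerivAt (by simp)
  have hd : DifferentiableAt ℝ (fderiv ℝ F) u :=
    (hF2.fderiv_right (m := 1) (by norm_num [one_add_one_eq_two])).differentiableAt (by simp)
  have key : ∀ a b : Fin 2, pd a (pd b F) u
      = fderiv ℝ (fderiv ℝ F) u (EuclideanSpace.single a 1) (EuclideanSpace.single b 1) := by
    intro a b
    have : pd b F = fun w => fderiv ℝ F w (EuclideanSpace.single b 1) := rfl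
    rw [pd, this, fderiv_clm_apply hd (differentiableAt_const _)]
    simp
  rw [key, key, hs]

lemma _root_.ContDiffOn.pd {F : Plane → V} {W : Set Plane} (hF : ContDiffOn ℝ ∞ F W) (hW : IsOpen W)
    (i : Fin 2) : ContDiffOn ℝ ∞ (DeSitterSurface.pd i F) W :=
  (hF.fderiv_of_isOpen hW (by simp)).clm_apply contDiffOn_const

lemma _root_.ContDiffOn.mink {F G : Plane → E51} {W : Set Plane} (hF : ContDiffOn ℝ ∞ F W)
    (hG : ContDiffOn ℝ ∞ G W) : ContDiffOn ℝ ∞ (fun w => DeSitterSurface.mink (F w) (G w)) W :=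
  (contDiffOn_const (c := minkCLM)).clm_apply hF |>.clm_apply hG

lemma _root_.ContDiffOn.differentiableAt' {F : Plane → V} {W : Set Plane} (hF : ContDiffOn ℝ ∞ F W)
    (hW : IsOpen W) {u : Plane} (hu : u ∈ W) : DifferentiableAt ℝ F u :=
  (hF.contDiffAt (hW.mem_nhds hu)).differentiableAt (by simp)

end Calculus

/-! ### Local geometry -/

/-- `X` is a smooth map from the open set `W` to the de Sitter space-time whose induced metric is
nondegenerate. -/
structure IsLocalSurface (X : Plane → E51) (W : Set Plane) : Prop where
  isOpen : IsOpen W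
  smooth : ContDiffOn ℝ ∞ X W
  unit : ∀ u ∈ W, mink (X u) (X u) = 1
  det_ne_zero : ∀ u ∈ W, (metric X u).det ≠ 0

/-- The second fundamental form of the surface in `𝔼⁵₁`. -/
def fullSecondForm (X : Plane → E51) (i j : Fin 2) (u : Plane) : E51 :=
  pd i (pd j X) u - ∑ k, christoffel X k i j u • pd k X u

lemma metric_apply (X : Plane → E51) (u : Plane) (i j : Fin 2) :
    metric X u i j = mink (pd i X u) (pd j X u) := rfl

lemma metric_symm (X : Plane → E51) (u : Plane) (i j : Fin 2) :
    metric X u i j = metric X u j i := mink_comm _ _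

lemma metric_inv (X : Plane → E51) (u : Plane) :
    (metric X u)⁻¹ = (metric X u).det⁻¹ •
      !![metric X u 1 1, -metric X u 0 1; -metric X u 1 0, metric X u 0 0] := by
  rw [Matrix.inv_def, Matrix.adjugate_fin_two, Ring.inverse_eq_inv']

lemma metric_inv_zero_zero (X : Plane → E51) (u : Plane) :
    (metric X u)⁻¹ 0 0 = metric X u 1 1 / (metric X u).det := by
  simp [metric_inv, div_eq_inv_mul]

lemma metric_inv_zero_one (X : Plane → E51) (u : Plane) :
    (metric X u)⁻¹ 0 1 = -metric X u 0 1 / (metric X u).det := by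
  simp [metric_inv, div_eq_inv_mul]

lemma metric_inv_one_zero (X : Plane → E51) (u : Plane) :
    (metric X u)⁻¹ 1 0 = -metric X u 0 1 / (metric X u).det := by
  simp [metric_inv, div_eq_inv_mul, metric_symm X u 1 0]

lemma metric_inv_one_one (X : Plane → E51) (u : Plane) :
    (metric X u)⁻¹ 1 1 = metric X u 0 0 / (metric X u).det := by
  simp [metric_inv, div_eq_inv_mul]

lemma metric_det (X : Plane → E51) (u : Plane) :
    (metric X u).det = metric X u 0 0 * metric X u 1 1 - metric X u 0 1 ^ 2 := by
  rw [Matrix.det_fin_two, metric_symm X u 1 0]; ring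

lemma christoffel_symm (X : Plane → E51) (k i j : Fin 2) (u : Plane) :
    christoffel X k i j u = christoffel X k j i u := by
  simp only [christoffel, metric_symm X _ j i]
  congr 1
  exact Finset.sum_congr rfl fun l _ => by ring

lemma pd_pd_eq (X : Plane → E51) (i j : Fin 2) (u : Plane) : pd i (pd j X) u
    = fullSecondForm X i j u + ∑ k, christoffel X k i j u • pd k X u := by
  simp [fullSecondForm]

namespace IsLocalSurface

variable {X : Plane → E51} {W : Set Plane} (hX : IsLocalSurface X W)
include hX

lemma smooth_pd (i : Fin 2) : ContDiffOn ℝ ∞ (pd i X) W := hX.smooth.pd hX.isOpen i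

lemma smooth_pd_pd (i j : Fin 2) : ContDiffOn ℝ ∞ (pd i (pd j X)) W :=
  (hX.smooth_pd j).pd hX.isOpen i

lemma smooth_metric (i j : Fin 2) : ContDiffOn ℝ ∞ (fun u => metric X u i j) W :=
  (hX.smooth_pd i).mink (hX.smooth_pd j)

lemma smooth_det : ContDiffOn ℝ ∞ (fun u => (metric X u).det) W := by
  simp only [Matrix.det_fin_two]
  exact ((hX.smooth_metric 0 0).mul (hX.smooth_metric 1 1)).sub
    ((hX.smooth_metric 0 1).mul (hX.smooth_metric 1 0))

lemma smooth_metric_inv (i j : Fin 2) : ContDiffOn ℝ ∞ (fun u => (metric X u)⁻¹ i j) W := by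
  have hd := hX.smooth_det.inv hX.det_ne_zero
  simp only [metric_inv]
  fin_cases i <;> fin_cases j <;> simp
  · exact hd.mul (hX.smooth_metric 1 1)
  · exact (hd.mul (hX.smooth_metric 0 1)).neg
  · exact (hd.mul (hX.smooth_metric 1 0)).neg
  · exact hd.mul (hX.smooth_metric 0 0)

lemma smooth_christoffel (k i j : Fin 2) : ContDiffOn ℝ ∞ (christoffel X k i j) W := by
  unfold christoffel
  refine contDiffOn_const.mul (ContDiffOn.sum fun l _ => (hX.smooth_metric_inv k l).mul ?_)
  exact (((hX.smooth_metric j l).pd hX.isOpen i).add ((hX.smooth_metric i l).pd hX.isOpen j)).sub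
    ((hX.smooth_metric i j).pd hX.isOpen l)

lemma smooth_fullSecondForm (i j : Fin 2) : ContDiffOn ℝ ∞ (fullSecondForm X i j) W := by
  unfold fullSecondForm
  exact (hX.smooth_pd_pd i j).sub
    (ContDiffOn.sum fun k _ => (hX.smooth_christoffel k i j).smul (hX.smooth_pd k))

variable {u : Plane} (hu : u ∈ W)
include hu

lemma pd_pd_comm (i j : Fin 2) : pd i (pd j X) u = pd j (pd i X) u :=
  pd_comm (hX.smooth.contDiffAt (hX.isOpen.mem_nhds hu)) i j

lemma pd_metric (i j k : Fin 2) : pd i (fun w => metric X w j k) u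
    = mink (pd i (pd j X) u) (pd k X u) + mink (pd j X u) (pd i (pd k X) u) :=
  pd_mink ((hX.smooth_pd j).differentiableAt' hX.isOpen hu)
    ((hX.smooth_pd k).differentiableAt' hX.isOpen hu)

/-- Koszul's formula: since mixed partials commute, the three metric derivatives in Γ combine to
2⟨∂ᵢ∂ⱼX, ∂ₗX⟩. Hence the Christoffel sum is the tangential part of ∂ᵢ∂ⱼX and `fullSecondForm` is
normal. -/
lemma sum_christoffel_mul_metric (i j m : Fin 2) :
    ∑ k, christoffel X k i j u * metric X u k m = mink (pd i (pd j X) u) (pd m X u) := by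
  have h : ∀ k, christoffel X k i j u
      = ∑ l, (metric X u)⁻¹ k l * mink (pd i (pd j X) u) (pd l X u) := by
    intro k
    rw [christoffel, Finset.mul_sum]
    refine Finset.sum_congr rfl fun l _ => ?_
    rw [hX.pd_metric hu, hX.pd_metric hu, hX.pd_metric hu, hX.pd_pd_comm hu j i,
      hX.pd_pd_comm hu l i, hX.pd_pd_comm hu l j, mink_comm (pd j X u) (pd i (pd l X) u),
      mink_comm (pd i X u) (pd j (pd l X) u)]
    ring
  have hd := hX.det_ne_zero u hu
  simp only [h, Finset.sum_mul]
  simp only [Fin.sum_univ_two, metric_inv]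
  have hD := metric_det X u
  rw [metric_symm X u 1 0] at *
  fin_cases m <;> simp <;> field_simp <;> rw [hD] <;> try rw [metric_symm X u 1 0]
  all_goals ring

lemma mink_fullSecondForm_pd (i j m : Fin 2) :
    mink (fullSecondForm X i j u) (pd m X u) = 0 := by
  have h := hX.sum_christoffel_mul_metric hu i j m
  simp only [Fin.sum_univ_two, metric_apply] at h
  simp only [fullSecondForm, Fin.sum_univ_two, mink_sub_left, mink_add_left, mink_smul_left]
  linarith

lemma mink_pd_self (i : Fin 2) : mink (pd i X u) (X u) = 0 := by
  have hd := hX.smooth.differentiableAt' hX.isOpen hu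
  have h1 : pd i (fun w => mink (X w) (X w)) u = 0 := by
    rw [pd_congr (G := fun _ => (1 : ℝ)), pd_const]
    filter_upwards [hX.isOpen.mem_nhds hu] with w hw using hX.unit w hw
  rw [pd_mink hd hd, mink_comm (X u)] at h1
  linarith

/-- Differentiate ⟨∂ⱼX, X⟩ = 0. This is what makes the position vector an umbilic normal direction.
-/
lemma mink_pd_pd_self (i j : Fin 2) : mink (pd i (pd j X) u) (X u) = -metric X u i j := by
  have h1 : pd i (fun w => mink (pd j X w) (X w)) u = 0 := by
    rw [pd_congr (G := fun _ => (0 : ℝ)), pd_const]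
    filter_upwards [hX.isOpen.mem_nhds hu] with w hw using hX.mink_pd_self hw j
  rw [pd_mink ((hX.smooth_pd j).differentiableAt' hX.isOpen hu)
    (hX.smooth.differentiableAt' hX.isOpen hu), ← metric_apply, metric_symm] at h1
  linarith

lemma mink_fullSecondForm_self (i j : Fin 2) :
    mink (fullSecondForm X i j u) (X u) = -metric X u i j := by
  simp only [fullSecondForm, Fin.sum_univ_two, mink_sub_left, mink_add_left, mink_smul_left,
    hX.mink_pd_pd_self hu, hX.mink_pd_self hu]
  ring

lemma fullSecondForm_symm (i j : Fin 2) : fullSecondForm X i j u = fullSecondForm X j i u := by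
  simp only [fullSecondForm, hX.pd_pd_comm hu i j, christoffel_symm X _ i j]

/-- The Weingarten relation, from differentiating ⟨h̃ᵢⱼ, ∂ₘX⟩ = 0; only the normal part of ∂ₗ∂ₘX
survives. -/
lemma mink_pd_fullSecondForm_pd (l i j m : Fin 2) :
    mink (pd l (fullSecondForm X i j) u) (pd m X u)
      = -mink (fullSecondForm X i j u) (fullSecondForm X l m u) := by
  have h1 : pd l (fun w => mink (fullSecondForm X i j w) (pd m X w)) u = 0 := by
    rw [pd_congr (G := fun _ => (0 : ℝ)), pd_const]
    filter_upwards [hX.isOpen.mem_nhds hu] with w hw using hX.mink_fullSecondForm_pd hw i j m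
  rw [pd_mink ((hX.smooth_fullSecondForm i j).differentiableAt' hX.isOpen hu)
    ((hX.smooth_pd m).differentiableAt' hX.isOpen hu)] at h1
  have h2 : mink (fullSecondForm X i j u) (pd l (pd m X) u)
      = mink (fullSecondForm X i j u) (fullSecondForm X l m u) := by
    rw [fullSecondForm.eq_1 X l m]
    simp only [Fin.sum_univ_two, mink_sub_right, mink_add_right, mink_smul_right,
      hX.mink_fullSecondForm_pd hu]
    ring
  linarith

lemma pd_metric_christoffel (l i j : Fin 2) : pd l (fun w => metric X w i j) u
    = (∑ k, christoffel X k l i u * metric X u k j)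
      + ∑ k, christoffel X k l j u * metric X u k i := by
  rw [hX.pd_metric hu, hX.sum_christoffel_mul_metric hu, hX.sum_christoffel_mul_metric hu,
    mink_comm (pd i X u)]

lemma mink_pd_fullSecondForm_self (l i j : Fin 2) :
    mink (pd l (fullSecondForm X i j) u) (X u) = -pd l (fun w => metric X w i j) u := by
  have h1 : pd l (fun w => mink (fullSecondForm X i j w) (X w)) u
      = -pd l (fun w => metric X w i j) u := by
    rw [pd_congr (G := fun w => -metric X w i j)]
    · rw [pd, pd, fderiv_fun_neg]; rfl
    filter_upwards [hX.isOpen.mem_nhds hu] with w hw using hX.mink_fullSecondForm_self hw i j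
  rw [pd_mink ((hX.smooth_fullSecondForm i j).differentiableAt' hX.isOpen hu)
    (hX.smooth.differentiableAt' hX.isOpen hu), hX.mink_fullSecondForm_pd hu] at h1
  linarith

/-- The Gauss equation for the surface in `𝔼⁵₁`. -/
lemma sum_riemann_mul_metric (i j k m : Fin 2) :
    ∑ l, riemann X l k i j u * metric X u l m
      = mink (fullSecondForm X j k u) (fullSecondForm X i m u)
        - mink (fullSecondForm X i k u) (fullSecondForm X j m u) := by
  have key : ∀ i j, mink (pd i (pd j (pd k X)) u) (pd m X u)
      = -mink (fullSecondForm X j k u) (fullSecondForm X i m u)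
        + ∑ l, (pd i (christoffel X l j k) u * metric X u l m
          + christoffel X l j k u * ∑ n, christoffel X n i l u * metric X u n m) := by
    intro i j
    have hG : ∀ l, DifferentiableAt ℝ (christoffel X l j k) u :=
      fun l => (hX.smooth_christoffel l j k).differentiableAt' hX.isOpen hu
    have hP : ∀ l, DifferentiableAt ℝ (pd l X) u :=
      fun l => (hX.smooth_pd l).differentiableAt' hX.isOpen hu
    have hs := fun l (_ : l ∈ Finset.univ) => (hG l).fun_smul (hP l)
    rw [pd_congr (G := fun w => fullSecondForm X j k w + ∑ l, christoffel X l j k w • pd l X w)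
      (by filter_upwards [hX.isOpen.mem_nhds hu] with w hw using pd_pd_eq X j k w),
      pd_add ((hX.smooth_fullSecondForm j k).differentiableAt' hX.isOpen hu)
        (DifferentiableAt.fun_sum hs), pd_sum hs, mink_add_left,
      hX.mink_pd_fullSecondForm_pd hu]
    congr 1
    simp only [pd_smul (hG _) (hP _), Fin.sum_univ_two, mink_add_left, mink_smul_left,
      ← hX.sum_christoffel_mul_metric hu i _ m, metric_apply]
    ring
  -- Flatness of 𝔼⁵₁ enters here: antisymmetrizing `key` in i, j leaves the curvature of Γ against
  -- the quadratic terms in h̃.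
  have hc : pd i (pd j (pd k X)) u = pd j (pd i (pd k X)) u :=
    pd_comm ((hX.smooth_pd k).contDiffAt (hX.isOpen.mem_nhds hu)) i j
  have h1 := key i j
  have h2 := key j i
  rw [hc, h2] at h1
  simp only [riemann, Fin.sum_univ_two] at h1 ⊢
  linarith

end IsLocalSurface

/-! ### The Laplacian of the Gauss map -/

lemma pd_pairing_wedge {F G : Plane → E51} {u : Plane} (a b : E51) (i : Fin 2)
    (hF : DifferentiableAt ℝ F u) (hG : DifferentiableAt ℝ G u) :
    pd i (fun w => pairing a b (wedge (F w) (G w))) u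
      = pairing a b (wedge (pd i F u) (G u)) + pairing a b (wedge (F u) (pd i G u)) := by
  have h : ∀ {E : Plane → E51} (c : E51), DifferentiableAt ℝ E u →
      DifferentiableAt ℝ (fun w => mink (E w) c) u := fun c hE =>
    ((differentiableAt_const minkCLM).clm_apply hE).clm_apply (differentiableAt_const c)
  simp only [pairing_wedge]
  rw [pd_sub ((h a hF).fun_mul (h b hG)) ((h b hF).fun_mul (h a hG)), pd_mul (h a hF) (h b hG),
    pd_mul (h b hF) (h a hG), pd_mink_const hF, pd_mink_const hF, pd_mink_const hG,
    pd_mink_const hG]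
  ring

lemma _root_.ContDiffOn.pairing_wedge {F G : Plane → E51} {W : Set Plane} (a b : E51)
    (hF : ContDiffOn ℝ ∞ F W) (hG : ContDiffOn ℝ ∞ G W) :
    ContDiffOn ℝ ∞ (fun w => pairing a b (wedge (F w) (G w))) W := by
  simp only [DeSitterSurface.pairing_wedge]
  exact ((hF.mink contDiffOn_const).mul (hG.mink contDiffOn_const)).sub
    ((hF.mink contDiffOn_const).mul (hG.mink contDiffOn_const))

/-- The component `⟨s ∂₀X ∧ ∂₁X, a ∧ b⟩` of a multiple of the tangent bivector. -/
def tangentComponent (X : Plane → E51) (s : Plane → ℝ) (a b : E51) (u : Plane) : ℝ :=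
  s u * pairing a b (wedge (pd 0 X u) (pd 1 X u))

namespace IsLocalSurface

variable {X : Plane → E51} {W : Set Plane} (hX : IsLocalSurface X W)
  {s : Plane → ℝ} (hs : ContDiffOn ℝ ∞ s W) (hsD : ∀ u ∈ W, s u ^ 2 * (metric X u).det = 1)
include hX hs

lemma smooth_tangentComponent (a b : E51) : ContDiffOn ℝ ∞ (tangentComponent X s a b) W :=
  hs.mul ((hX.smooth_pd 0).pairing_wedge a b (hX.smooth_pd 1))

include hsD
variable {u : Plane} (hu : u ∈ W)
include hu

/-- Up to sign, s is (det g)^(-1/2), and metric compatibility gives ∂ᵢ det g = 2 det g · Γᵏᵢₖ. -/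
lemma pd_factor (i : Fin 2) :
    pd i s u = -s u * ∑ k, christoffel X k i k u := by
  have hm := fun j k => (hX.smooth_metric j k).differentiableAt' hX.isOpen hu
  have hs' := hs.differentiableAt' hX.isOpen hu
  have hD : pd i (fun w => (metric X w).det) u
      = 2 * (metric X u).det * ∑ k, christoffel X k i k u := by
    rw [pd_congr (G := fun w => metric X w 0 0 * metric X w 1 1 - metric X w 0 1 * metric X w 0 1)
      (Filter.Eventually.of_forall fun w => by simp only [metric_det, sq]),
      pd_sub ((hm 0 0).fun_mul (hm 1 1)) ((hm 0 1).fun_mul (hm 0 1)), pd_mul (hm 0 0) (hm 1 1),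
      pd_mul (hm 0 1) (hm 0 1)]
    simp only [hX.pd_metric_christoffel hu, metric_det, Fin.sum_univ_two, metric_symm X u 1 0]
    ring
  have h1 : pd i (fun w => s w * s w * (metric X w).det) u = 0 := by
    rw [pd_congr (G := fun _ => (1 : ℝ)), pd_const]
    filter_upwards [hX.isOpen.mem_nhds hu] with w hw using by rw [← sq, hsD w hw]
  rw [pd_mul (hs'.fun_mul hs') (hX.smooth_det.differentiableAt' hX.isOpen hu), pd_mul hs' hs',
    hD] at h1
  have h0 : 2 * s u * (metric X u).det ≠ 0 := by
    intro h
    have := hsD u hu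
    have : 2 * (s u ^ 2 * (metric X u).det) = 0 := by linear_combination s u * h
    linarith
  apply mul_left_cancel₀ h0
  linear_combination h1

/-- The tangential parts of ∂ᵢ∂₀X and ∂ᵢ∂₁X contribute Γᵏᵢₖ ν, which the derivative of s cancels. -/
lemma pd_tangentComponent (a b : E51) (i : Fin 2) :
    pd i (tangentComponent X s a b) u
      = s u * (pairing a b (wedge (fullSecondForm X i 0 u) (pd 1 X u))
        + pairing a b (wedge (pd 0 X u) (fullSecondForm X i 1 u))) := by
  have hP := fun j => (hX.smooth_pd j).differentiableAt' hX.isOpen hu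
  unfold tangentComponent
  rw [pd_mul (hs.differentiableAt' hX.isOpen hu)
    (((hX.smooth_pd 0).pairing_wedge a b (hX.smooth_pd 1)).differentiableAt' hX.isOpen hu),
    hX.pd_factor hs hsD hu, pd_pairing_wedge a b i (hP 0) (hP 1), pd_pd_eq, pd_pd_eq]
  simp only [pairing_wedge, Fin.sum_univ_two, mink_add_left, mink_smul_left]
  ring

lemma pd_pd_tangentComponent (a b : E51) (j i : Fin 2) :
    pd j (pd i (tangentComponent X s a b)) u
      = -s u * (∑ k, christoffel X k j k u)
          * (pairing a b (wedge (fullSecondForm X i 0 u) (pd 1 X u))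
            + pairing a b (wedge (pd 0 X u) (fullSecondForm X i 1 u)))
        + s u * (pairing a b (wedge (pd j (fullSecondForm X i 0) u) (pd 1 X u))
          + pairing a b (wedge (fullSecondForm X i 0 u) (pd j (pd 1 X) u))
          + pairing a b (wedge (pd j (pd 0 X) u) (fullSecondForm X i 1 u))
          + pairing a b (wedge (pd 0 X u) (pd j (fullSecondForm X i 1) u))) := by
  have hP := fun j => (hX.smooth_pd j).differentiableAt' hX.isOpen hu
  have hh := fun j => (hX.smooth_fullSecondForm i j).differentiableAt' hX.isOpen hu
  have h0 := ((hX.smooth_fullSecondForm i 0).pairing_wedge a b (hX.smooth_pd 1)).differentiableAt'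
    hX.isOpen hu
  have h1 := ((hX.smooth_pd 0).pairing_wedge a b (hX.smooth_fullSecondForm i 1)).differentiableAt'
    hX.isOpen hu
  rw [pd_congr (by
    filter_upwards [hX.isOpen.mem_nhds hu] with w hw using hX.pd_tangentComponent hs hsD hw a b i),
    pd_mul (hs.differentiableAt' hX.isOpen hu) (h0.fun_add h1),
    hX.pd_factor hs hsD hu, pd_add h0 h1, pd_pairing_wedge a b j (hh 0) (hP 1),
    pd_pairing_wedge a b j (hP 0) (hh 1)]
  ring

/-- The component of `Δν` along `ν`. -/
lemma localLaplacian_tangentComponent_tangent :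
    localLaplacian X (tangentComponent X s (pd 0 X u) (pd 1 X u)) u
      = (4 - 2 * localGaussCurvature X u
          + 4 * mink (localMeanCurvature X u) (localMeanCurvature X u))
        * tangentComponent X s (pd 0 X u) (pd 1 X u) u := by
  have hdet := hX.det_ne_zero u hu
  have hK : localGaussCurvature X u = (mink (fullSecondForm X 1 1 u) (fullSecondForm X 0 0 u)
      - mink (fullSecondForm X 0 1 u) (fullSecondForm X 0 1 u)) / (metric X u).det := by
    rw [localGaussCurvature, hX.sum_riemann_mul_metric hu, hX.fullSecondForm_symm hu 1 0]
  have hh : ∀ i j, secondFundForm X i j u = fullSecondForm X i j u + metric X u i j • X u := by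
    intro i j
    rw [secondFundForm, ambientCovDeriv, fullSecondForm, hX.mink_pd_pd_self hu]
    module
  -- From 2H = tr h̃ + 2X with ⟨tr h̃, X⟩ = -2. The -4 here accounts for the 4 in the formula for f.
  have hH : 4 * mink (localMeanCurvature X u) (localMeanCurvature X u)
      = mink (∑ i, ∑ j, (metric X u)⁻¹ i j • fullSecondForm X i j u)
        (∑ i, ∑ j, (metric X u)⁻¹ i j • fullSecondForm X i j u) - 4 := by
    have hXh : ∀ i j, mink (X u) (fullSecondForm X i j u) = -metric X u i j := fun i j => by
      rw [mink_comm, hX.mink_fullSecondForm_self hu]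
    have h2 : ∑ i, ∑ j, (metric X u)⁻¹ i j * metric X u i j = 2 := by
      simp only [Fin.sum_univ_two, metric_inv_zero_zero, metric_inv_zero_one, metric_inv_one_zero,
        metric_inv_one_one, metric_symm X u 1 0]
      field_simp
      rw [metric_det]
      ring
    have hsum : ∑ i, ∑ j, (metric X u)⁻¹ i j • secondFundForm X i j u
        = (∑ i, ∑ j, (metric X u)⁻¹ i j • fullSecondForm X i j u) + (2 : ℝ) • X u := by
      rw [← h2]
      simp only [hh, Fin.sum_univ_two]
      module
    have hin : mink (∑ i, ∑ j, (metric X u)⁻¹ i j • fullSecondForm X i j u) (X u) = -2 := by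
      rw [← h2]
      simp only [Fin.sum_univ_two, mink_add_left, mink_smul_left, hX.mink_fullSecondForm_self hu]
      ring
    rw [localMeanCurvature, hsum, mink_smul_left, mink_smul_right]
    simp only [mink_add_left, mink_add_right, mink_smul_left, mink_smul_right, hX.unit u hu]
    rw [mink_comm (X u), hin]
    ring
  have hd := metric_det X u
  -- What remains is |h̃|² = |tr h̃|² - 2K, a rational identity in the gᵢⱼ and the products ⟨h̃ᵢⱼ,
  -- h̃ₖₗ⟩.
  rw [hK, hH]
  rw [tangentComponent.eq_1 X s (pd 0 X u) (pd 1 X u) u]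
  simp only [localLaplacian, hX.pd_pd_tangentComponent hs hsD hu,
    hX.pd_tangentComponent hs hsD hu,
    pairing_wedge, Fin.sum_univ_two, hX.mink_fullSecondForm_pd hu,
    hX.mink_pd_fullSecondForm_pd hu, mink_add_left, mink_smul_left, mink_add_right,
    mink_smul_right, hX.fullSecondForm_symm hu 1 0, metric_inv_zero_zero, metric_inv_zero_one,
    metric_inv_one_zero, metric_inv_one_one, ← metric_apply, metric_symm X u 1 0, zero_mul,
    mul_zero, add_zero, sub_zero, zero_add]
  simp only [mink_comm (fullSecondForm X 0 1 u) (fullSecondForm X 0 0 u),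
    mink_comm (fullSecondForm X 1 1 u) (fullSecondForm X 0 0 u),
    mink_comm (fullSecondForm X 1 1 u) (fullSecondForm X 0 1 u)]
  generalize (metric X u).det = D at *
  field_simp
  rw [hd]
  ring

/-- `Δν` is orthogonal to all `x ∧ b`. -/
lemma localLaplacian_tangentComponent_position (b : E51) :
    localLaplacian X (tangentComponent X s (X u) b) u = 0 := by
  have hdet := hX.det_ne_zero u hu
  simp only [localLaplacian, hX.pd_pd_tangentComponent hs hsD hu,
    hX.pd_tangentComponent hs hsD hu,
    pairing_wedge, hX.mink_fullSecondForm_self hu,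
    hX.mink_pd_fullSecondForm_self hu, hX.mink_pd_pd_self hu, hX.mink_pd_self hu,
    hX.pd_metric_christoffel hu]
  -- Derivatives of h̃ paired with `b` are already gone, being multiplied by ⟨∂ₖX, X⟩ = 0. Splitting
  -- ∂ᵢ∂ⱼX lets the Christoffel terms cancel those from the derivatives of g.
  simp only [pd_pd_eq X _ _ u]
  simp only [Fin.sum_univ_two, mink_add_left, mink_smul_left, hX.fullSecondForm_symm hu 1 0,
    christoffel_symm X _ 1 0 u, metric_inv_zero_zero, metric_inv_zero_one,
    metric_inv_one_zero, metric_inv_one_one, metric_symm X u 1 0]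
  generalize (metric X u).det = D at *
  field_simp
  ring

/-- If the second fundamental form of the surface in the de Sitter space-time vanishes at a point,
then `Δν` has no normal component there. -/
lemma localLaplacian_tangentComponent_normal {a b : E51}
    (ha : ∀ i, mink (pd i X u) a = 0) (hb : ∀ i, mink (pd i X u) b = 0)
    (ha' : ∀ i j, mink (pd i (pd j X) u) a = 0) (hb' : ∀ i j, mink (pd i (pd j X) u) b = 0) :
    localLaplacian X (tangentComponent X s a b) u = 0 := by
  have h : ∀ c, (∀ i, mink (pd i X u) c = 0) → (∀ i j, mink (pd i (pd j X) u) c = 0) →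
      ∀ i j, mink (fullSecondForm X i j u) c = 0 := fun c hc hc' i j => by
    simp [fullSecondForm, mink_sub_left, mink_add_left, mink_smul_left, hc, hc']
  simp [localLaplacian, hX.pd_pd_tangentComponent hs hsD hu, hX.pd_tangentComponent hs hsD hu,
    pairing_wedge, ha, hb, ha', hb', h a ha ha', h b hb hb']

end IsLocalSurface

/-! ### Linearity of the Laplacian and the vanishing of `C`. -/

lemma localLaplacian_congr {X : Plane → E51} {φ ψ : Plane → ℝ} {u : Plane}
    (h : φ =ᶠ[nhds u] ψ) : localLaplacian X φ u = localLaplacian X ψ u := by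
  simp only [localLaplacian, pd_congr h, pd_congr (pd_eventuallyEq h)]

lemma localLaplacian_sum {ι : Type*} [Fintype ι] (X : Plane → E51) {W : Set Plane}
    (hW : IsOpen W) {u : Plane} (hu : u ∈ W) (c : ι → ℝ) {φ : ι → Plane → ℝ}
    (hφ : ∀ k, ContDiffOn ℝ ∞ (φ k) W) :
    localLaplacian X (fun w => ∑ k, c k * φ k w) u = ∑ k, c k * localLaplacian X (φ k) u := by
  have h1 : ∀ {ψ : ι → Plane → ℝ}, (∀ k, ContDiffOn ℝ ∞ (ψ k) W) → ∀ i, ∀ w ∈ W,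
      pd i (fun w => ∑ k, c k * ψ k w) w = ∑ k, c k * pd i (ψ k) w := by
    intro ψ hψ i w hw
    have hd := fun k => (hψ k).differentiableAt' hW hw
    rw [pd_sum fun k _ => (differentiableAt_const (c k)).fun_mul (hd k)]
    refine Finset.sum_congr rfl fun k _ => ?_
    rw [pd_mul (differentiableAt_const (c k)) (hd k), pd_const]
    ring
  have h2 : ∀ i j, pd i (pd j (fun w => ∑ k, c k * φ k w)) u
      = ∑ k, c k * pd i (pd j (φ k)) u := by
    intro i j
    rw [pd_congr (by filter_upwards [hW.mem_nhds hu] with w hw using h1 hφ j w hw),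
      h1 (fun k => (hφ k).pd hW j) i u hu]
  simp only [localLaplacian, h2, h1 hφ _ u hu, Fin.sum_univ_two, Finset.mul_sum,
    ← Finset.sum_sub_distrib, ← Finset.sum_add_distrib, ← Finset.sum_neg_distrib]
  exact Finset.sum_congr rfl fun k _ => by ring

lemma pd_pairing {F : Plane → E51} {u : Plane} (hF : DifferentiableAt ℝ F u) (i : Fin 2)
    (b : E51) (C : Bivector) :
    pd i (fun w => pairing (F w) b C) u = pairing (pd i F u) b C := by
  have h := ((LinearMap.toContinuousLinearMap
    ((pairingBilin C).flip b)).hasFDerivAt (x := F u)).comp u hF.hasFDerivAt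
  have h' : HasFDerivAt (fun w => pairing (F w) b C) _ u := h
  rw [pd, h'.fderiv]
  rfl

lemma fderiv_eq_pd (F : Plane → E51) (u v : Plane) :
    fderiv ℝ F u v = v 0 • pd 0 F u + v 1 • pd 1 F u := by
  have hv : v = v 0 • EuclideanSpace.single 0 1 + v 1 • EuclideanSpace.single 1 1 := by
    ext i; fin_cases i <;> simp
  conv_lhs => rw [hv]
  rw [map_add, map_smul, map_smul]
  rfl

lemma IsLocalSurface.mono {X : Plane → E51} {W W' : Set Plane} (hX : IsLocalSurface X W)
    (hW' : IsOpen W') (h : W' ⊆ W) : IsLocalSurface X W' :=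
  ⟨hW', hX.smooth.mono h, fun u hu => hX.unit u (h hu), fun u hu => hX.det_ne_zero u (h hu)⟩

namespace IsLocalSurface

variable {X : Plane → E51} {W : Set Plane} (hX : IsLocalSurface X W) {u : Plane} (hu : u ∈ W)
include hX hu

/-- The Gram matrix of the three vectors is the nonsingular block matrix 1 ⊕ g. -/
lemma linearIndependent_frame : LinearIndependent ℝ ![X u, pd 0 X u, pd 1 X u] := by
  rw [Fintype.linearIndependent_iff]
  intro g hg
  simp only [Fin.sum_univ_three, Matrix.cons_val] at hg
  have hm := fun v => congrArg (fun y => mink y v) hg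
  have hz : ∀ v : E51, mink 0 v = 0 := fun v => by simp [mink]
  simp only [mink_add_left, mink_smul_left, hz] at hm
  have h0 := hm (X u)
  have h1 := hm (pd 0 X u)
  have h2 := hm (pd 1 X u)
  rw [hX.unit u hu, hX.mink_pd_self hu, hX.mink_pd_self hu] at h0
  rw [mink_comm (X u), hX.mink_pd_self hu, ← metric_apply, ← metric_apply,
    metric_symm X u 1 0] at h1
  rw [mink_comm (X u), hX.mink_pd_self hu, ← metric_apply, ← metric_apply] at h2
  have hd := hX.det_ne_zero u hu
  have e1 : g 1 * (metric X u).det = 0 := by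
    rw [metric_det]; linear_combination metric X u 1 1 * h1 - metric X u 0 1 * h2
  have e2 : g 2 * (metric X u).det = 0 := by
    rw [metric_det]; linear_combination metric X u 0 0 * h2 - metric X u 0 1 * h1
  intro i
  fin_cases i
  · simpa using h0
  · exact (mul_eq_zero.mp e1).resolve_right hd
  · exact (mul_eq_zero.mp e2).resolve_right hd

/-- Every vector has an orthogonal projection to the span of `X`, `∂₀X`, `∂₁X`. -/
lemma exists_sub_orthogonal (v : E51) :
    ∃ t ∈ Submodule.span ℝ (Set.range ![X u, pd 0 X u, pd 1 X u]),
      mink (X u) (v - t) = 0 ∧ ∀ i, mink (pd i X u) (v - t) = 0 := by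
  have hmem : ∀ i, ![X u, pd 0 X u, pd 1 X u] i
      ∈ Submodule.span ℝ (Set.range ![X u, pd 0 X u, pd 1 X u]) := fun i =>
    Submodule.subset_span ⟨i, rfl⟩
  have hd := hX.det_ne_zero u hu
  have hX' : ∀ i, mink (X u) (pd i X u) = 0 := fun i => by rw [mink_comm, hX.mink_pd_self hu]
  -- The coefficients of ∂₀X and ∂₁X are g⁻¹ applied to the products ⟨∂ᵢX, v⟩.
  refine ⟨mink (X u) v • X u
    + ((metric X u 1 1 * mink (pd 0 X u) v - metric X u 0 1 * mink (pd 1 X u) v)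
        / (metric X u).det) • pd 0 X u
    + ((metric X u 0 0 * mink (pd 1 X u) v - metric X u 0 1 * mink (pd 0 X u) v)
        / (metric X u).det) • pd 1 X u,
    add_mem (add_mem (Submodule.smul_mem _ _ (hmem 0)) (Submodule.smul_mem _ _ (hmem 1)))
      (Submodule.smul_mem _ _ (hmem 2)), ?_, ?_⟩
  · simp only [mink_sub_right, mink_add_right, mink_smul_right, hX.unit u hu, hX']
    ring
  · have hdet := metric_det X u
    intro i
    simp only [mink_sub_right, mink_add_right, mink_smul_right, hX.mink_pd_self hu,
      ← metric_apply]
    fin_cases i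
    all_goals
      simp only [Fin.zero_eta, Fin.mk_one, metric_symm X u 1 0]
      generalize (metric X u).det = D at *
      field_simp
      rw [hdet]
      ring

/-- If `Δν = r (ν + C)` at a point with `r ≠ 0`, and `C` is orthogonal to all `X ∧ b` near this
point, then `C = 0`. -/
lemma eq_zero_of_laplacian_eq {s : Plane → ℝ} (hs : ContDiffOn ℝ ∞ s W)
    (hsD : ∀ u ∈ W, s u ^ 2 * (metric X u).det = 1) {C : Bivector} {r : ℝ} (hr : r ≠ 0)
    (hC : ∀ᶠ w in nhds u, ∀ b, pairing (X w) b C = 0)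
    (hL : ∀ a b, localLaplacian X (tangentComponent X s a b) u
      = r * (tangentComponent X s a b u + pairing a b C)) : C = 0 := by
  -- Since `C` is constant, a field lying in its radical near `u` has derivatives lying there too.
  have hpd : ∀ {F : Plane → E51}, ContDiffOn ℝ ∞ F W →
      (∀ᶠ w in nhds u, ∀ b, pairing (F w) b C = 0) →
      ∀ i, ∀ᶠ w in nhds u, ∀ b, pairing (pd i F w) b C = 0 := by
    intro F hF h i
    filter_upwards [h.eventually_nhds, hX.isOpen.mem_nhds hu] with w hw hwW b
    rw [← pd_pairing (hF.differentiableAt' hX.isOpen hwW),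
      pd_congr (G := fun _ => (0 : ℝ)) (by filter_upwards [hw] with z hz using hz b), pd_const]
  have h1 := fun i => hpd hX.smooth hC i
  have h2 := fun i j => (hpd (hX.smooth_pd j) (h1 j) i).self_of_nhds
  set T := Submodule.span ℝ (Set.range ![X u, pd 0 X u, pd 1 X u]) with hT
  have hTN : T ≤ LinearMap.ker (pairingBilin C) := by
    rw [hT, Submodule.span_le]
    rintro _ ⟨i, rfl⟩
    rw [SetLike.mem_coe, LinearMap.mem_ker]
    refine LinearMap.ext fun b => ?_
    fin_cases i
    · exact hC.self_of_nhds b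
    · exact (h1 0).self_of_nhds b
    · exact (h1 1).self_of_nhds b
  by_cases h4 : 4 ≤ Module.finrank ℝ (LinearMap.ker (pairingBilin C))
  · exact eq_zero_of_four_le_finrank h4
  have hTeq : T = LinearMap.ker (pairingBilin C) := by
    apply Submodule.eq_of_le_of_finrank_le hTN
    rw [hT, finrank_span_eq_card (hX.linearIndependent_frame hu), Fintype.card_fin]
    omega
  -- Equivalently, the second fundamental form in the de Sitter space vanishes at `u`.
  have hmem : ∀ i j, pd i (pd j X) u ∈ T := by
    intro i j
    rw [hTeq, LinearMap.mem_ker]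
    refine LinearMap.ext fun b => ?_
    exact h2 i j b
  have horth : ∀ {v : E51}, mink (X u) v = 0 → (∀ i, mink (pd i X u) v = 0) →
      ∀ t ∈ T, mink t v = 0 := by
    intro v hv hv' t ht
    have : T ≤ LinearMap.ker (minkBilin.flip v) := by
      rw [hT, Submodule.span_le]
      rintro _ ⟨i, rfl⟩
      rw [SetLike.mem_coe, LinearMap.mem_ker]
      fin_cases i
      · exact hv
      · exact hv' 0
      · exact hv' 1
    exact LinearMap.mem_ker.mp (this ht)
  apply eq_zero_of_pairing_eq_zero
  intro a b
  obtain ⟨t, ht, ha, ha'⟩ := hX.exists_sub_orthogonal hu a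
  obtain ⟨t', ht', hb, hb'⟩ := hX.exists_sub_orthogonal hu b
  have hz : ∀ t ∈ T, ∀ c, pairing t c C = 0 := fun t ht c => by
    rw [← pairingBilin_apply, LinearMap.mem_ker.mp (hTN ht)]; rfl
  -- `T` lies in the radical, so only the parts of `a` and `b` orthogonal to `T` matter.
  have hab : pairing a b C = pairing (a - t) (b - t') C := by
    have e : pairing (a - t) t' C = 0 := by rw [pairing_swap, hz t' ht', neg_zero]
    simp only [← pairingBilin_apply] at hz e ⊢
    rw [map_sub, e, map_sub, LinearMap.sub_apply, hz t ht]; ring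
  have h := hL (a - t) (b - t')
  rw [hX.localLaplacian_tangentComponent_normal hs hsD hu ha' hb'
    (fun i j => horth ha ha' _ (hmem i j)) (fun i j => horth hb hb' _ (hmem i j)),
    tangentComponent, pairing_wedge, ha', ha'] at h
  rw [hab]
  have := (mul_eq_zero.mp h.symm).resolve_left hr
  simpa using this

end IsLocalSurface

/-! ### Reading surfaces in charts -/

/-- A pairing with fixed a ∧ b is a constant combination of coordinates, so it commutes with the
Laplacian. Test vectors adapted to the point may thus replace the standard basis. -/
lemma pairing_bivectorLaplacian {M : Type*} [TopologicalSpace M] [ChartedSpace Plane M]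
    {x : M → E51} {ν : M → Bivector} {p : M} {W : Set Plane} {s : Plane → ℝ}
    (hX : IsLocalSurface (readAt p x) W) (hp : chartAt Plane p p ∈ W) (hs : ContDiffOn ℝ ∞ s W)
    (hν : ∀ u ∈ W, readAt p ν u = s u • wedge (pd 0 (readAt p x) u) (pd 1 (readAt p x) u))
    (a b : E51) :
    pairing a b (bivectorLaplacian x ν p)
      = localLaplacian (readAt p x) (tangentComponent (readAt p x) s a b) (chartAt Plane p p) := by
  choose A B hAB using exists_repr_eq_pairing
  have h1 : ∀ k, laplacian x (fun q => bivectorBasis.repr (ν q) k) p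
      = localLaplacian (readAt p x) (tangentComponent (readAt p x) s (A k) (B k))
        (chartAt Plane p p) := by
    intro k
    refine localLaplacian_congr ?_
    filter_upwards [hX.isOpen.mem_nhds hp] with w hw
    have : readAt p (fun q => bivectorBasis.repr (ν q) k) w
        = bivectorBasis.repr (readAt p ν w) k := rfl
    rw [this, hν w hw, hAB, map_smul]
    rfl
  have h2 : tangentComponent (readAt p x) s a b = fun w => ∑ k, pairing a b (bivectorBasis k)
      * tangentComponent (readAt p x) s (A k) (B k) w := by
    funext w
    rw [tangentComponent, pairing_eq_sum_repr, Finset.mul_sum]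
    refine Finset.sum_congr rfl fun k _ => ?_
    rw [hAB, tangentComponent]
    ring
  rw [h2, localLaplacian_sum (readAt p x) hX.isOpen hp _
    fun k => hX.smooth_tangentComponent hs (A k) (B k), bivectorLaplacian, map_sum]
  refine Finset.sum_congr rfl fun k _ => ?_
  rw [h1, map_smul, smul_eq_mul, mul_comm]

section Charts

variable {M : Type*} [TopologicalSpace M] [ChartedSpace Plane M] [IsManifold (𝓡 2) ∞ M]
  {x : M → E51} (hx : IsSpacelikeSurface x)
include hx

lemma fderiv_readAt (p : M) {u : Plane} (hu : u ∈ (chartAt Plane p).target) (v : Plane) :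
    fderiv ℝ (readAt p x) u v = mfderiv (𝓡 2) 𝓘(ℝ, E51) x ((chartAt Plane p).symm u)
      (mfderiv (𝓡 2) (𝓡 2) (chartAt Plane p).symm u v) := by
  have h1 : MDifferentiableAt (𝓡 2) 𝓘(ℝ, E51) x ((chartAt Plane p).symm u) :=
    (hx.smooth _).mdifferentiableAt (by simp)
  have h2 : MDifferentiableAt (𝓡 2) (𝓡 2) (chartAt Plane p).symm u :=
    mdifferentiableAt_atlas_symm (chart_mem_atlas _ p) hu
  rw [← mfderiv_eq_fderiv, readAt, mfderiv_comp u h1 h2]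
  rfl

lemma isLocalSurface_readAt (p : M) :
    IsLocalSurface (readAt p x) (chartAt Plane p).target where
  isOpen := (chartAt Plane p).open_target
  smooth := (hx.smooth.comp_contMDiffOn (contMDiffOn_chart_symm (n := ∞) (x := p))).contDiffOn
  unit u _ := hx.mem_deSitter _
  det_ne_zero u hu := by
    have hinj := (mdifferentiable_chart (I := 𝓡 2) p).symm.mfderiv_injective hu
    have hpos : ∀ v : Plane, v ≠ 0 → 0 < v 0 ^ 2 * metric (readAt p x) u 0 0
        + 2 * (v 0 * v 1) * metric (readAt p x) u 0 1 + v 1 ^ 2 * metric (readAt p x) u 1 1 := by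
      intro v hv
      have h := hx.spacelike ((chartAt Plane p).symm u)
        (mfderiv (𝓡 2) (𝓡 2) (chartAt Plane p).symm u v)
        (fun h => hv (hinj (h.trans (map_zero _).symm)))
      rw [← fderiv_readAt hx p hu, fderiv_eq_pd] at h
      simp only [mink_add_left, mink_add_right, mink_smul_left, mink_smul_right,
        ← metric_apply, metric_symm _ u 1 0] at h
      linarith
    have h0 := hpos (EuclideanSpace.single 0 1) (by simp)
    simp at h0
    -- On this vector the quadratic form takes the value g₀₀ det g.
    have h1 := hpos (!₂[-metric (readAt p x) u 0 1, metric (readAt p x) u 0 0]) (by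
      intro h
      have := congrArg (fun v : Plane => v 1) h
      simp at this
      linarith)
    simp at h1
    intro hd
    rw [metric_det] at hd
    nlinarith

/-- In the chart at `p`, the Gauss map is a smooth multiple of `∂₀X ∧ ∂₁X`. -/
lemma exists_gaussMap_eq {ν : M → Bivector} (hν : IsGaussMap x ν) (p : M) :
    ∃ (W : Set Plane) (s : Plane → ℝ), IsLocalSurface (readAt p x) W ∧ chartAt Plane p p ∈ W ∧
      ContDiffOn ℝ ∞ s W ∧ (∀ u ∈ W, s u ^ 2 * (metric (readAt p x) u).det = 1) ∧
      ∀ u ∈ W, readAt p ν u = s u • wedge (pd 0 (readAt p x) u) (pd 1 (readAt p x) u) := by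
  obtain ⟨U, hU, hpU, e₁, e₂, he, hνe⟩ := hν p
  have hX := isLocalSurface_readAt hx p
  set c := chartAt Plane p with hc
  set X := readAt p x with hXdef
  have hWo : IsOpen (c.target ∩ c.symm ⁻¹' U) := c.isOpen_inter_preimage_symm hU
  have hX' := hX.mono hWo Set.inter_subset_left
  have hsm : ∀ {e : M → E51}, ContMDiffOn (𝓡 2) 𝓘(ℝ, E51) ∞ e U →
      ContDiffOn ℝ ∞ (readAt p e) (c.target ∩ c.symm ⁻¹' U) := fun h =>
    (h.comp ((contMDiffOn_chart_symm (n := ∞) (x := p)).mono Set.inter_subset_left)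
      Set.inter_subset_right).contDiffOn
  have htan : ∀ {e : M → E51}, (∀ q ∈ U, ∃ v : TangentSpace (𝓡 2) q,
      e q = mfderiv (𝓡 2) 𝓘(ℝ, E51) x q v) → ∀ u ∈ c.target ∩ c.symm ⁻¹' U,
      ∃ α β : ℝ, readAt p e u = α • pd 0 X u + β • pd 1 X u := by
    intro e h u hu
    obtain ⟨v, hv⟩ := h _ hu.2
    obtain ⟨w, hw⟩ := (mdifferentiable_chart (I := 𝓡 2) p).symm.mfderiv_surjective hu.1 v
    refine ⟨(show Plane from w) 0, (show Plane from w) 1, ?_⟩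
    rw [hXdef, ← fderiv_eq_pd, fderiv_readAt hx p hu.1]
    exact hv.trans (congrArg _ hw.symm)
  -- The factor is written as ⟨e₁ ∧ e₂, ∂₀X ∧ ∂₁X⟩ / det g, which is visibly smooth, whereas the
  -- frame coefficients from `htan` are only chosen pointwise.
  have key : ∀ u ∈ c.target ∩ c.symm ⁻¹' U,
      ((mink (readAt p e₁ u) (pd 0 X u) * mink (readAt p e₂ u) (pd 1 X u)
        - mink (readAt p e₁ u) (pd 1 X u) * mink (readAt p e₂ u) (pd 0 X u))
          / (metric X u).det) ^ 2 * (metric X u).det = 1 ∧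
      readAt p ν u = ((mink (readAt p e₁ u) (pd 0 X u) * mink (readAt p e₂ u) (pd 1 X u)
        - mink (readAt p e₁ u) (pd 1 X u) * mink (readAt p e₂ u) (pd 0 X u))
          / (metric X u).det) • wedge (pd 0 X u) (pd 1 X u) := by
    intro u hu
    obtain ⟨α, β, h₁⟩ := htan he.tangent₁ u hu
    obtain ⟨γ, δ, h₂⟩ := htan he.tangent₂ u hu
    have g₁ : mink (readAt p e₁ u) (readAt p e₁ u) = 1 := he.unit₁ _ hu.2
    have g₂ : mink (readAt p e₂ u) (readAt p e₂ u) = 1 := he.unit₂ _ hu.2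
    have g₃ : mink (readAt p e₁ u) (readAt p e₂ u) = 0 := he.orthogonal _ hu.2
    have hν' : readAt p ν u = wedge (readAt p e₁ u) (readAt p e₂ u) := hνe _ hu.2
    have hd := hX.det_ne_zero u hu.1
    have hs : (mink (readAt p e₁ u) (pd 0 X u) * mink (readAt p e₂ u) (pd 1 X u)
        - mink (readAt p e₁ u) (pd 1 X u) * mink (readAt p e₂ u) (pd 0 X u))
          / (metric X u).det = α * δ - β * γ := by
      rw [div_eq_iff hd, h₁, h₂, metric_det]
      simp only [mink_add_left, mink_smul_left, ← metric_apply, metric_symm X u 1 0]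
      ring
    rw [hs, hν', h₁, h₂, wedge_combination]
    refine ⟨?_, rfl⟩
    rw [h₁] at g₁ g₃
    rw [h₂] at g₂ g₃
    simp only [mink_add_left, mink_smul_left, mink_add_right, mink_smul_right, ← metric_apply,
      metric_symm X u 1 0] at g₁ g₂ g₃
    rw [metric_det]
    -- (αδ - βγ)² det g is the Gram determinant |e₁|²|e₂|² - ⟨e₁,e₂⟩²; the coefficients of `g₂` and
    -- `g₃` are |e₁|² and -⟨e₁,e₂⟩.
    linear_combination g₁ + (α * (α * metric X u 0 0 + β * metric X u 0 1)
      + β * (α * metric X u 0 1 + β * metric X u 1 1)) * g₂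
      - (α * (γ * metric X u 0 0 + δ * metric X u 0 1)
      + β * (γ * metric X u 0 1 + δ * metric X u 1 1)) * g₃
  refine ⟨_, _, hX', ⟨mem_chart_target _ p, ?_⟩, ?_, fun u hu => (key u hu).1,
    fun u hu => (key u hu).2⟩
  · rw [Set.mem_preimage, c.left_inv (mem_chart_source _ p)]
    exact hpU
  · exact ((((hsm he.smooth₁).mink (hX'.smooth_pd 0)).mul
      ((hsm he.smooth₂).mink (hX'.smooth_pd 1))).sub
      (((hsm he.smooth₁).mink (hX'.smooth_pd 1)).mul
        ((hsm he.smooth₂).mink (hX'.smooth_pd 0)))).div hX'.smooth_det hX'.det_ne_zero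

end Charts

end DeSitterSurface

end

/-! ### The theorem on `M`. -/

open DeSitterSurface in
theorem mainTheorem1 {M : Type*} [TopologicalSpace M]
    [ChartedSpace DeSitterSurface.Plane M] [IsManifold (𝓡 2) ∞ M]
    (x : M → DeSitterSurface.E51) (hx : DeSitterSurface.IsSpacelikeSurface x)
    (ν : M → DeSitterSurface.Bivector) (hν : DeSitterSurface.IsGaussMap x ν)
    (f : M → ℝ) (C : DeSitterSurface.Bivector)
    (h : DeSitterSurface.PointwiseOneTypeEq x ν f C) :
    (∀ p, f p = 4 - 2 * DeSitterSurface.gaussCurvature x p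
        + 4 * DeSitterSurface.mink (DeSitterSurface.meanCurvature x p)
            (DeSitterSurface.meanCurvature x p)) ∧
      ((∃ p, f p ≠ 0) → C = 0) ∧
      DeSitterSurface.PointwiseOneTypeEq x ν
        (fun p => 4 - 2 * DeSitterSurface.gaussCurvature x p
          + 4 * DeSitterSurface.mink (DeSitterSurface.meanCurvature x p)
              (DeSitterSurface.meanCurvature x p)) 0 := by
  obtain ⟨hf, hΔ⟩ := h
  have hread : ∀ {V : Type} (F : M → V) (p : M), readAt p F (chartAt Plane p p) = F p :=
    fun F p => by rw [readAt, Function.comp_apply, (chartAt Plane p).left_inv (mem_chart_source _ p)]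
  have hposition : ∀ p b, f p * pairing (x p) b C = 0 := by
    intro p b
    obtain ⟨W, s, hX, hp, hs, hsD, hνs⟩ := exists_gaussMap_eq hx hν p
    have h1 := pairing_bivectorLaplacian hX hp hs hνs (readAt p x (chartAt Plane p p)) b
    rw [hX.localLaplacian_tangentComponent_position hs hsD hp, hΔ, ← hread ν p, hνs _ hp] at h1
    simp only [map_smul, map_add, pairing_wedge, hX.mink_pd_self hp, smul_eq_mul] at h1
    rw [← hread x p]
    linarith
  have hCzero : (∃ p, f p ≠ 0) → C = 0 := by
    rintro ⟨p, hfp⟩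
    obtain ⟨W, s, hX, hp, hs, hsD, hνs⟩ := exists_gaussMap_eq hx hν p
    refine hX.eq_zero_of_laplacian_eq hp hs hsD hfp ?_ fun a b => ?_
    -- Continuity keeps f nonzero nearby, so X is in the radical of `C` on a neighbourhood and the
    -- relation can be differentiated.
    · have hcont : ContinuousAt (f ∘ (chartAt Plane p).symm) (chartAt Plane p p) :=
        (hf.continuous.continuousAt).comp
          ((chartAt Plane p).continuousAt_symm (mem_chart_target _ p))
      have hne : (f ∘ (chartAt Plane p).symm) (chartAt Plane p p) ≠ 0 := by
        rwa [Function.comp_apply, (chartAt Plane p).left_inv (mem_chart_source _ p)]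
      filter_upwards [hcont.eventually_ne hne] with w hw b
      exact (mul_eq_zero.mp (hposition _ b)).resolve_left hw
    · rw [← pairing_bivectorLaplacian hX hp hs hνs, hΔ, map_smul, map_add, smul_eq_mul,
        ← hread ν p, hνs _ hp, map_smul]
      rfl
  have hformula : ∀ p, f p = 4 - 2 * gaussCurvature x p
      + 4 * mink (meanCurvature x p) (meanCurvature x p) := by
    intro p
    obtain ⟨W, s, hX, hp, hs, hsD, hνs⟩ := exists_gaussMap_eq hx hν p
    set u := chartAt Plane p p
    have h1 := pairing_bivectorLaplacian hX hp hs hνs (pd 0 (readAt p x) u) (pd 1 (readAt p x) u)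
    have hfC : f p • C = 0 := by
      by_cases h0 : f p = 0
      · rw [h0, zero_smul]
      · rw [hCzero ⟨p, h0⟩, smul_zero]
    -- ⟨ν, ∂₀X ∧ ∂₁X⟩ = s det g is nonzero, so it can be cancelled, even where f vanishes.
    have hne : tangentComponent (readAt p x) s (pd 0 (readAt p x) u) (pd 1 (readAt p x) u) u
        ≠ 0 := by
      have hD := hsD u hp
      have : tangentComponent (readAt p x) s (pd 0 (readAt p x) u) (pd 1 (readAt p x) u) u
          = s u * (metric (readAt p x) u).det := by
        simp only [tangentComponent, pairing_wedge, ← metric_apply, metric_det,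
          metric_symm (readAt p x) u 1 0]
        ring
      rw [this]
      intro h0
      have : s u ^ 2 * (metric (readAt p x) u).det = 0 := by linear_combination s u * h0
      linarith
    rw [hX.localLaplacian_tangentComponent_tangent hs hsD hp, hΔ, smul_add, hfC, add_zero,
      map_smul, ← hread ν p, hνs _ hp, map_smul] at h1
    exact mul_right_cancel₀ hne h1
  refine ⟨hformula, hCzero, ?_⟩
  -- Replacing the curvature expression by f makes its smoothness that of f.
  simp only [← hformula]
  refine ⟨hf, fun p => ?_⟩
  rw [hΔ p]
  by_cases h0 : f p = 0
  · simp only [h0, zero_smul]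
  · rw [hCzero ⟨p, h0⟩]
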